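/- Let $G$ be a connected compact (real, finite-dimensional) semisimple Lie group with identity $e$ and Lie algebra $\mathfrak g=T_eG$, that is, $\mathfrak g$ is a semisimple Lie algebra. Let $\varphi=\{\varphi_t\}_{t\in\mathbb R}$ be a flow of automorphisms of $G$, i.e. a (smooth) one-parameter group of Lie group automorphisms: $\varphi_0=\mathrm{id}$, $\varphi_{s+t}=\varphi_s\circ\varphi_t$, each $\varphi_t$ is an automorphism of $G$, and $(t,g)\mapsto\varphi_t(g)$ is smooth. Then: 1. The negative Killing form $\langle X,Y\rangle=-\operatorname{tr}(\operatorname{ad}X\,\operatorname{ad}Y)$ is an inner product on $\mathfrak g$ which is invariant under $(d\varphi_t)_e$ for all $t\in\mathbb R$. 2. $\varphi$ is elliptic: there is a (necessarily unique) derivation $\mathcal D$ of $\mathfrak g$ with $(d\varphi_t)_e=\mathrm e^{t\mathcal D}$ for all $t\in\mathbb R$, and $\mathcal D$ is semisimple with all of its complex eigenvalues purely imaginary (possibly $0$). 3. $\varphi$ is chain transitive. Here, for a neighborhood $U$ of $e$ and $\tau>0$, a $(U,\tau)$-chain from $x$ to $y$ consists of $n\ge 1$, points $x_0=x,x_1,\dots,x_n=y$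 of $G$ and times $\tau_0,\dots,\tau_{n-1}\ge\tau$ with $x_{i+1}^{-1}\varphi_{\tau_i}(x_i)\in U$ for $0\le i<n$; $\Omega(x)$ is the set of all $y$ such that for every $U$ and $\tau$ there is a $(U,\tau)$-chain from $x$ to $y$; the chain recurrent set is $\{x : x\in\Omega(x)\}$; the chain transitive components are the classes in the chain recurrent set of the equivalence relation "$x\in\Omega(y)$ and $y\in\Omega(x)$"; and $\varphi$ is chain transitive if $G$ is contained in a chain transitive component. -/

import Mathlib

open scoped Manifold ContDiff Topology

noncomputable section

namespace AutomorphismFlow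

/-- A linear endomorphism of a real vector space is *elliptic* if it is semisimple and all of its
(complex) eigenvalues, i.e. the eigenvalues of its complexification, are purely imaginary
(the eigenvalue `0` is allowed). -/
def IsEllipticEnd {V : Type*} [AddCommGroup V] [Module ℝ V] (D : Module.End ℝ V) : Prop :=
  D.IsSemisimple ∧
    ∀ z : ℂ, Module.End.HasEigenvalue (LinearMap.baseChange ℂ D) z → z.re = 0

/-- The exponential of an endomorphism of a finite-dimensional real normed space. -/
def expEnd {E : Type*} [NormedAddCommGroup E] [NormedSpace ℝ E] [FiniteDimensional ℝ E]
    (A : E →ₗ[ℝ] E) : E →L[ℝ] E :=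
  NormedSpace.exp (LinearMap.toContinuousLinearMap A)

section LieGroup

variable {E : Type*} [NormedAddCommGroup E] [NormedSpace ℝ E]

/-- The smoothness class in which Mathlib defines the Lie algebra of a Lie group is implied by
smoothness. -/
instance lieGroup_minSmoothness (G : Type*) [TopologicalSpace G] [ChartedSpace E G] [Group G]
    [LieGroup 𝓘(ℝ, E) ∞ G] : LieGroup 𝓘(ℝ, E) (minSmoothness ℝ 3) G :=
  LieGroup.of_le (n := ∞) (by simpa using ENat.LEInfty.out)

variable (E) in
/-- The Lie algebra `𝔤 = T_e G` of a real Lie group `G` modelled on `E`. -/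
abbrev LieAlg (G : Type*) [TopologicalSpace G] [ChartedSpace E G] [Group G] : Type _ :=
  GroupLieAlgebra 𝓘(ℝ, E) G

variable (E) in
/-- A *flow of automorphisms* of a Lie group `G`: a (smooth) one-parameter group
`t ↦ φ_t` of automorphisms of the Lie group `G`. -/
structure Flow (G : Type*) [TopologicalSpace G] [ChartedSpace E G] [Group G] where
  /-- the automorphism `φ_t` -/
  toFun : ℝ → MulAut G
  map_zero' : toFun 0 = 1
  map_add' : ∀ s t : ℝ, toFun (s + t) = toFun s * toFun t
  smooth' : ContMDiff (𝓘(ℝ, ℝ).prod 𝓘(ℝ, E)) 𝓘(ℝ, E) ∞ (fun p : ℝ × G => toFun p.1 p.2)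

namespace Flow

variable {G : Type*} [TopologicalSpace G] [ChartedSpace E G] [Group G]

instance : CoeFun (Flow E G) (fun _ => ℝ → MulAut G) := ⟨Flow.toFun⟩

/-- The differential `(dφ_t)_e : T_e G → T_e G`. The automorphism `φ_t` fixes `e`, so that
the target `T_{φ_t e} G` of the manifold derivative at `e` is `T_e G`. -/
def diffAtOne (φ : Flow E G) (t : ℝ) : LieAlg E G →L[ℝ] LieAlg E G :=
  (mfderiv 𝓘(ℝ, E) 𝓘(ℝ, E) (fun g : G => φ t g) (1 : G) : E →L[ℝ] E)

/-- `D` is the derivation associated with the flow `φ`: `(dφ_t)_e = exp (t D)` for all `t`. -/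
def HasDerivation [FiniteDimensional ℝ E] [CompleteSpace E] [LieGroup 𝓘(ℝ, E) ∞ G]
    (φ : Flow E G) (D : LieDerivation ℝ (LieAlg E G) (LieAlg E G)) : Prop :=
  ∀ t : ℝ, φ.diffAtOne t = expEnd (E := E) (t • (D : LieAlg E G →ₗ[ℝ] LieAlg E G))

/-- A flow of automorphisms is *elliptic* if it has an associated derivation (necessarily
unique) and this derivation is elliptic. -/
def IsElliptic [FiniteDimensional ℝ E] [CompleteSpace E] [LieGroup 𝓘(ℝ, E) ∞ G]
    (φ : Flow E G) : Prop :=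
  ∃ D : LieDerivation ℝ (LieAlg E G) (LieAlg E G), φ.HasDerivation D ∧
    IsEllipticEnd (D : LieAlg E G →ₗ[ℝ] LieAlg E G)

/-- There is a `(U, τ)`-chain from `x` to `y`: points `x_0 = x, …, x_n = y` and times
`τ_0, …, τ_{n-1} ≥ τ`, with at least one jump (`n ≥ 1`), such that
`x_{i+1}⁻¹ φ_{τ_i}(x_i) ∈ U` for all `i < n`. (Values of the sequences at larger indices are
irrelevant.) -/
def ExistsChain (φ : Flow E G) (U : Set G) (τ : ℝ) (x y : G) : Prop :=
  ∃ (n : ℕ) (ξ : ℕ → G) (s : ℕ → ℝ), 1 ≤ n ∧ ξ 0 = x ∧ ξ n = y ∧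
    ∀ i < n, τ ≤ s i ∧ (ξ (i + 1))⁻¹ * φ (s i) (ξ i) ∈ U

/-- The chain limit set `Ω(x)`. -/
def chainLimitSet (φ : Flow E G) (x : G) : Set G :=
  {y | ∀ U ∈ 𝓝 (1 : G), ∀ τ : ℝ, 0 < τ → φ.ExistsChain U τ x y}

/-- The chain recurrent set of the flow. -/
def chainRecurrentSet (φ : Flow E G) : Set G :=
  {x | x ∈ φ.chainLimitSet x}

/-- The chain transitive components: the classes in the chain recurrent set of the relation
`x ∈ Ω(y)` and `y ∈ Ω(x)`. -/
def IsChainTransitiveComponent (φ : Flow E G) (C : Set G) : Prop :=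
  ∃ x ∈ φ.chainRecurrentSet,
    C = {y | y ∈ φ.chainRecurrentSet ∧ x ∈ φ.chainLimitSet y ∧ y ∈ φ.chainLimitSet x}

/-- A subset of `G` is chain transitive if it is contained in a chain transitive component. -/
def IsChainTransitiveSet (φ : Flow E G) (F : Set G) : Prop :=
  ∃ C, φ.IsChainTransitiveComponent C ∧ F ⊆ C

/-- The flow is chain transitive if `G` is a chain transitive subset. -/
def IsChainTransitive (φ : Flow E G) : Prop :=
  φ.IsChainTransitiveSet Set.univ

end Flow

end LieGroup

end AutomorphismFlow

end

/-!
Averaging over Haar measure gives an `Ad`-invariant inner product on the Lie algebra. Every `ad X`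
is skew for it, so `tr (ad X)² < 0` unless `ad X = 0`; since the center is trivial, the Killing form
is negative definite. Automorphisms preserve the Killing form and derivations are skew for it, and a
skew endomorphism for a definite form is semisimple with purely imaginary spectrum.

A continuous automorphism of `G` preserves Haar measure, so by Poincaré recurrence arbitrarily
small perturbations close up its orbits. Hence the points reachable by chains from a given point
form a clopen set, which is `G` by connectedness.
-/

noncomputable section

namespace AutomorphismFlow

section Skew

variable {K V : Type*} [Field K] [AddCommGroup V] [Module K V]

open Module.End in
theorem isSemisimple_of_isSkewAdjoint [FiniteDimensional K V] {B : LinearMap.BilinForm K V}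
    (hB : B.IsRefl) (hB₀ : ∀ x, B x x = 0 → x = 0) {D : Module.End K V}
    (hD : B.IsSkewAdjoint D) : D.IsSemisimple := by
  refine isSemisimple_iff.2 fun p hp => ⟨B.orthogonal p, fun x hx y hy => ?_, ?_⟩
  · have h : B (D y) x = -B y (D x) := by simpa using hD y x
    exact neg_eq_zero.1 (h.symm.trans (hx (D y) (hp hy)))
  · exact (LinearMap.BilinForm.isCompl_orthogonal_iff_disjoint hB).2 <|
      Submodule.disjoint_def.2 fun x hx hx' => hB₀ x (hx' x hx)

end Skew

section RealForms

variable {V : Type*} [AddCommGroup V] [Module ℝ V]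

theorem exists_real_quadratic_of_hasEigenvalue_baseChange {D : Module.End ℝ V} {z : ℂ}
    (hz : Module.End.HasEigenvalue (D.baseChange ℂ) z) :
    ∃ v ≠ 0, D (D v) - (2 * z.re) • D v + Complex.normSq z • v = 0 := by
  let P : Module.End ℝ V := D * D - (2 * z.re) • D + Complex.normSq z • 1
  suffices h : ¬ Function.Injective P by
    obtain ⟨v, hv, hv₀⟩ : ∃ v, P v = 0 ∧ v ≠ 0 := by
      simpa [injective_iff_map_eq_zero] using h
    exact ⟨v, hv₀, by simpa [P] using hv⟩
  intro hP
  obtain ⟨w, hw, hw₀⟩ := hz.exists_hasEigenvector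
  have hDw : D.baseChange ℂ w = z • w := Module.End.mem_eigenspace_iff.1 hw
  have hroot : z * z - ((2 * z.re : ℝ) : ℂ) * z + (Complex.normSq z : ℂ) = 0 := by
    apply Complex.ext <;> simp [Complex.normSq_apply] <;> ring
  have hPw : P.baseChange ℂ w = 0 := by
    have : P.baseChange ℂ w = (z * z - ((2 * z.re : ℝ) : ℂ) * z + (Complex.normSq z : ℂ)) • w := by
      simp only [P, LinearMap.baseChange_add, LinearMap.baseChange_sub, LinearMap.baseChange_smul,
        LinearMap.baseChange_mul, LinearMap.add_apply, LinearMap.sub_apply, LinearMap.smul_apply,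
        Module.End.mul_apply, hDw, map_smul, LinearMap.baseChange_one, Module.End.one_apply]
      rw [← algebraMap_smul ℂ (2 * z.re), ← algebraMap_smul ℂ (Complex.normSq z)]
      simp only [Complex.coe_algebraMap]
      module
    rw [this, hroot, zero_smul]
  exact hw₀ (Module.Flat.lTensor_preserves_injective_linearMap (M := ℂ) P hP
    (hPw.trans (map_zero _).symm))

theorem re_eq_zero_of_isSkewAdjoint {B : LinearMap.BilinForm ℝ V} (hB : B.IsSymm)
    (hB₀ : ∀ x, B x x = 0 → x = 0) {D : Module.End ℝ V} (hD : B.IsSkewAdjoint D) {z : ℂ}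
    (hz : Module.End.HasEigenvalue (D.baseChange ℂ) z) : z.re = 0 := by
  obtain ⟨v, hv₀, hv⟩ := exists_real_quadratic_of_hasEigenvalue_baseChange hz
  have hskew : ∀ x, B (D x) x = 0 := fun x => by
    have h : B (D x) x = -B x (D x) := by simpa using hD x x
    have h' : B x (D x) = B (D x) x := hB.eq x (D x)
    linarith
  have hpair : 2 * z.re * B (D v) (D v) = 0 := by
    have h := congrArg (B · (D v)) hv
    have hvD : B v (D v) = 0 := (hB.eq v (D v)).trans (hskew v)
    simpa [hskew (D v), hvD] using h
  rcases mul_eq_zero.1 hpair with hre | hDv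
  · simpa using hre
  · have h : Complex.normSq z • v = 0 := by simpa [hB₀ _ hDv] using hv
    rw [Complex.normSq_eq_zero.1 ((smul_eq_zero.1 h).resolve_right hv₀), Complex.zero_re]

theorem isEllipticEnd_of_isSkewAdjoint [FiniteDimensional ℝ V] {B : LinearMap.BilinForm ℝ V}
    (hB : B.IsSymm) (hB₀ : ∀ x, B x x = 0 → x = 0) {D : Module.End ℝ V}
    (hD : B.IsSkewAdjoint D) : IsEllipticEnd D :=
  ⟨isSemisimple_of_isSkewAdjoint hB.isRefl hB₀ hD, fun _ => re_eq_zero_of_isSkewAdjoint hB hB₀ hD⟩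

theorem trace_mul_self_neg_of_isSkewAdjoint [FiniteDimensional ℝ V]
    {B : LinearMap.BilinForm ℝ V} (hB : B.IsSymm) (hpos : ∀ x ≠ 0, 0 < B x x)
    {A : Module.End ℝ V} (hA : B.IsSkewAdjoint A) (hA₀ : A ≠ 0) :
    LinearMap.trace ℝ V (A * A) < 0 := by
  let core : InnerProductSpace.Core ℝ V :=
    { inner := fun x y => B x y
      conj_inner_symm := fun x y => hB.eq y x
      re_inner_nonneg := fun x => by
        rcases eq_or_ne x 0 with rfl | hx
        · simp
        · exact (hpos x hx).le
      definite := fun x hx => by_contra fun hx₀ => (hpos x hx₀).ne' hx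
      add_left := by simp
      smul_left := by simp }
  let _ : NormedAddCommGroup V := core.toNormedAddCommGroup
  let _ : InnerProductSpace ℝ V := .ofCore core.toCore
  let b := stdOrthonormalBasis ℝ V
  have hterm : ∀ i, inner ℝ (b i) ((A * A) (b i)) = -‖A (b i)‖ ^ 2 := fun i => by
    have h : B (A (b i)) (A (b i)) = -B (b i) (A (A (b i))) := by simpa using hA (b i) (A (b i))
    rw [← real_inner_self_eq_norm_sq]
    exact (neg_eq_iff_eq_neg.2 h).symm
  obtain ⟨i, hi⟩ : ∃ i, A (b i) ≠ 0 := by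
    by_contra! h
    exact hA₀ (b.toBasis.ext fun i => by simpa using h i)
  rw [LinearMap.trace_eq_sum_inner _ b, Finset.sum_congr rfl fun i _ => hterm i]
  exact Finset.sum_neg' (fun i _ => neg_nonpos.2 (sq_nonneg _))
    ⟨i, Finset.mem_univ i, neg_neg_of_pos (pow_pos (norm_pos_iff.2 hi) 2)⟩

end RealForms

section KillingForm

theorem killingForm_isSkewAdjoint {R L : Type*} [CommRing R] [LieRing L] [LieAlgebra R L]
    (D : LieDerivation R L L) :
    LinearMap.IsSkewAdjoint (killingForm R L) (D : Module.End R L) := by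
  intro X Y
  have had : ∀ Z, LieAlgebra.ad R L (D Z) =
      (D : Module.End R L) * LieAlgebra.ad R L Z - LieAlgebra.ad R L Z * (D : Module.End R L) :=
    fun Z => by
      ext W
      simp
  have hcycle := LinearMap.trace_mul_comm R (D : Module.End R L)
    (LieAlgebra.ad R L X * LieAlgebra.ad R L Y)
  simp only [Pi.neg_apply, map_neg, LieDerivation.coeFn_coe, killingForm_apply_apply, had,
    ← Module.End.mul_eq_comp, sub_mul, mul_sub, map_sub, mul_assoc, hcycle, neg_sub]

theorem killingForm_neg_of_lieInvariant {L : Type*} [LieRing L] [LieAlgebra ℝ L]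
    [FiniteDimensional ℝ L] (hcenter : LieAlgebra.center ℝ L = ⊥) {B : LinearMap.BilinForm ℝ L}
    (hB : B.IsSymm) (hpos : ∀ x ≠ 0, 0 < B x x) (hinv : B.lieInvariant L) {X : L} (hX : X ≠ 0) :
    killingForm ℝ L X X < 0 := by
  refine trace_mul_self_neg_of_isSkewAdjoint hB hpos (A := LieAlgebra.ad ℝ L X)
    (fun Y Z => (hinv X Y Z).trans (map_neg (B Y) _).symm) fun had => hX ?_
  have hmem : X ∈ LieAlgebra.center ℝ L := by
    rw [← LieAlgebra.self_module_ker_eq_center, LieModule.mem_ker]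
    exact fun Y => LinearMap.congr_fun had Y
  simpa [hcenter] using hmem

end KillingForm

section HaarAverage

open MeasureTheory

variable {G : Type*} [TopologicalSpace G] [Group G] [IsTopologicalGroup G] [CompactSpace G]
  {E : Type*} [NormedAddCommGroup E] [NormedSpace ℝ E]

/-- The average `(x, y) ↦ ∫ β (ρ(g)⁻¹ x) (ρ(g)⁻¹ y) dg` of a bilinear form over a representation
of a compact group, with respect to the Haar measure. -/
def haarAverage [MeasurableSpace G] [BorelSpace G] (ρ : G →* (E →L[ℝ] E))
    (β : E →L[ℝ] E →L[ℝ] ℝ) : E →L[ℝ] E →L[ℝ] ℝ :=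
  ∫ g, β.bilinearComp (ρ g⁻¹) (ρ g⁻¹) ∂Measure.haar

variable {ρ : G →* (E →L[ℝ] E)} (hρ : Continuous ρ)

include hρ

set_option maxSynthPendingDepth 3 in
theorem haarAverage_apply [MeasurableSpace G] [BorelSpace G] (β : E →L[ℝ] E →L[ℝ] ℝ) (x y : E) :
    haarAverage ρ β x y = ∫ g, β (ρ g⁻¹ x) (ρ g⁻¹ y) ∂Measure.haar := by
  have hcont : Continuous fun g => β.bilinearComp (ρ g⁻¹) (ρ g⁻¹) := by
    have hflip := (ContinuousLinearMap.flipₗᵢ ℝ E E ℝ).continuous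
    have hinv : Continuous fun g => ρ g⁻¹ := hρ.comp continuous_inv
    exact hflip.comp ((hflip.comp (continuous_const.clm_comp hinv)).clm_comp hinv)
  have hint : Integrable (fun g => β.bilinearComp (ρ g⁻¹) (ρ g⁻¹)) Measure.haar :=
    hcont.integrable_of_hasCompactSupport (HasCompactSupport.of_compactSpace _)
  rw [haarAverage, ContinuousLinearMap.integral_apply hint,
    ContinuousLinearMap.integral_apply (hint.apply_continuousLinearMap x)]
  simp only [ContinuousLinearMap.bilinearComp_apply]

theorem haarAverage_apply_map_map [MeasurableSpace G] [BorelSpace G] (β : E →L[ℝ] E →L[ℝ] ℝ)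
    (g : G) (x y : E) : haarAverage ρ β (ρ g x) (ρ g y) = haarAverage ρ β x y := by
  rw [haarAverage_apply hρ, haarAverage_apply hρ,
    ← integral_mul_left_eq_self (fun h => β (ρ h⁻¹ x) (ρ h⁻¹ y)) g⁻¹]
  simp only [mul_inv_rev, inv_inv, map_mul, mul_apply_eq_comp]

theorem haarAverage_apply_self_pos [MeasurableSpace G] [BorelSpace G] {β : E →L[ℝ] E →L[ℝ] ℝ}
    (hβ : ∀ x ≠ 0, 0 < β x x) {x : E} (hx : x ≠ 0) : 0 < haarAverage ρ β x x := by
  have hnonneg : ∀ y, 0 ≤ β y y := fun y => by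
    rcases eq_or_ne y 0 with rfl | hy
    · simp
    · exact (hβ y hy).le
  have hcont : Continuous fun g => β (ρ g⁻¹ x) (ρ g⁻¹ x) := by fun_prop
  rw [haarAverage_apply hρ]
  exact hcont.integral_pos_of_hasCompactSupport_nonneg_nonzero
    (HasCompactSupport.of_compactSpace _) (fun g => hnonneg _) (x := 1)
    (by simpa using (hβ x hx).ne')

theorem exists_isSymm_pos_invariant_bilinForm [FiniteDimensional ℝ E] :
    ∃ B : LinearMap.BilinForm ℝ E, B.IsSymm ∧ (∀ x ≠ 0, 0 < B x x) ∧
      ∀ g x y, B (ρ g x) (ρ g y) = B x y := by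
  borelize G
  let e : E →L[ℝ] _ := (toEuclidean (E := E)).toContinuousLinearMap
  let β : E →L[ℝ] E →L[ℝ] ℝ := (innerSL ℝ).bilinearComp e e
  have hβ : ∀ x ≠ 0, 0 < β x x := fun x hx =>
    real_inner_self_pos.2 ((map_ne_zero_iff _ (toEuclidean (E := E)).injective).2 hx)
  refine ⟨(haarAverage ρ β).toLinearMap₁₂, ⟨fun x y => ?_⟩,
    fun x hx => haarAverage_apply_self_pos hρ hβ hx, haarAverage_apply_map_map hρ β⟩
  change haarAverage ρ β x y = haarAverage ρ β y x
  have hsymm : ∀ u v, β u v = β v u := fun u v => real_inner_comm (e v) (e u)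
  simp only [haarAverage_apply hρ, hsymm (ρ _ x)]

end HaarAverage

section Calculus

open ContinuousLinearMap

section PartialDerivatives

variable {E F H : Type*} [NormedAddCommGroup E] [NormedSpace ℝ E] [NormedAddCommGroup F]
  [NormedSpace ℝ F] [NormedAddCommGroup H] [NormedSpace ℝ H] {f : E × F → H} {a : E} {b : F}

theorem hasFDerivAt_fderiv_snd (hf : ContDiffAt ℝ 2 f (a, b)) :
    HasFDerivAt (fun x => fderiv ℝ (fun y => f (x, y)) b)
      ((compL ℝ F (E × F) H).flip (inr ℝ E F) ∘L fderiv ℝ (fderiv ℝ f) (a, b) ∘L inl ℝ E F) a := by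
  have hf' : HasFDerivAt (fderiv ℝ f) (fderiv ℝ (fderiv ℝ f) (a, b)) (a, b) :=
    ((hf.fderiv_right (m := 1) (by norm_num)).differentiableAt (by norm_num)).hasFDerivAt
  have hpair : HasFDerivAt (fun x : E => (x, b)) (inl ℝ E F) a := hasFDerivAt_prodMk_left a b
  refine (((compL ℝ F (E × F) H).flip (inr ℝ E F)).hasFDerivAt.comp a
    (hf'.comp a hpair)).congr_of_eventuallyEq ?_
  filter_upwards [hpair.continuousAt.eventually (hf.eventually (by simp))] with x hx
  exact ((hx.differentiableAt (by norm_num)).hasFDerivAt.comp b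
    (hasFDerivAt_prodMk_right x b)).fderiv

theorem hasFDerivAt_fderiv_fst (hf : ContDiffAt ℝ 2 f (a, b)) :
    HasFDerivAt (fun y => fderiv ℝ (fun x => f (x, y)) a)
      ((compL ℝ E (E × F) H).flip (inl ℝ E F) ∘L fderiv ℝ (fderiv ℝ f) (a, b) ∘L inr ℝ E F) b := by
  have hf' : HasFDerivAt (fderiv ℝ f) (fderiv ℝ (fderiv ℝ f) (a, b)) (a, b) :=
    ((hf.fderiv_right (m := 1) (by norm_num)).differentiableAt (by norm_num)).hasFDerivAt
  have hpair : HasFDerivAt (fun y : F => (a, y)) (inr ℝ E F) b := hasFDerivAt_prodMk_right a b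
  refine (((compL ℝ E (E × F) H).flip (inl ℝ E F)).hasFDerivAt.comp b
    (hf'.comp b hpair)).congr_of_eventuallyEq ?_
  filter_upwards [hpair.continuousAt.eventually (hf.eventually (by simp))] with y hy
  exact ((hy.differentiableAt (by norm_num)).hasFDerivAt.comp a
    (hasFDerivAt_prodMk_left a y)).fderiv

theorem fderiv_fderiv_snd_eq_fderiv_fderiv_fst (hf : ContDiffAt ℝ 2 f (a, b)) (X : E) (Y : F) :
    fderiv ℝ (fun x => fderiv ℝ (fun y => f (x, y)) b) a X Y =
      fderiv ℝ (fun y => fderiv ℝ (fun x => f (x, y)) a) b Y X := by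
  rw [(hasFDerivAt_fderiv_snd hf).fderiv, (hasFDerivAt_fderiv_fst hf).fderiv]
  exact (hf.isSymmSndFDerivAt (by simp)).eq (X, 0) (0, Y)

end PartialDerivatives

section Bilinear

variable {E F U : Type*} [NormedAddCommGroup E] [NormedSpace ℝ E] [NormedAddCommGroup F]
  [NormedSpace ℝ F] [NormedAddCommGroup U] [NormedSpace ℝ U]

theorem bilin_deriv_add_bilin_deriv_eq (B : U →L[ℝ] U →L[ℝ] F) {T : E → U →L[ℝ] U}
    {T' : E →L[ℝ] U →L[ℝ] U} {s : E → F} {s' : E →L[ℝ] F} {a : E} (hT : HasFDerivAt T T' a)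
    (hTa : T a = 1) (hs : HasFDerivAt s s' a) {u v : U} (h : ∀ x, B (T x u) (T x v) = s x)
    (X : E) : B (T' X u) v + B u (T' X v) = s' X := by
  have hT_apply : ∀ w, HasFDerivAt (fun x => T x w) (T'.flip w) a := fun w =>
    (apply ℝ U w).hasFDerivAt.comp a hT
  have hB := B.hasFDerivAt_of_bilinear (hT_apply u) (hT_apply v)
  simp only [h, hTa] at hB
  simpa [add_comm] using DFunLike.congr_fun (hB.unique hs) X

theorem deriv_bilin_eq_of_forall_bilin_eq (B : U →L[ℝ] U →L[ℝ] U) {T : ℝ → U →L[ℝ] U}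
    {D : U →L[ℝ] U} {a : ℝ} (hT : HasDerivAt T D a) (hTa : T a = 1)
    (h : ∀ t u v, B (T t u) (T t v) = T t (B u v)) (u v : U) :
    D (B u v) = B (D u) v + B u (D v) := by
  have hTB := hT.clm_apply (hasDerivAt_const a (B u v))
  simpa using (bilin_deriv_add_bilin_deriv_eq B hT.hasFDerivAt hTa hTB.hasFDerivAt
    (fun t => h t u v) 1).symm

end Bilinear

section LocalGroup

variable {E : Type*} [NormedAddCommGroup E] [NormedSpace ℝ E]

-- If `m` is the multiplication of a Lie group in a chart at its identity `a`, then `K` is the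
-- adjoint representation and the right-hand side is the bracket of left-invariant vector fields.
theorem fderiv_apply_eq_lieBracket_of_fderiv_eq_mul {m : E × E → E} {K : E → E →L[ℝ] E} {a : E}
    (hm : ContDiffAt ℝ 2 m (a, a)) (hm_left : ∀ᶠ x in 𝓝 a, m (a, x) = x)
    (hm_right : ∀ᶠ x in 𝓝 a, m (x, a) = x) (hK : DifferentiableAt ℝ K a)
    (hmK : ∀ᶠ x in 𝓝 a,
      fderiv ℝ (fun y => m (x, y)) a = fderiv ℝ (fun y => m (y, x)) a * K x) (X Y : E) :
    fderiv ℝ K a X Y = VectorField.lieBracket ℝ (fun x => fderiv ℝ (fun y => m (x, y)) a X)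
      (fun x => fderiv ℝ (fun y => m (x, y)) a Y) a := by
  set L : E → E →L[ℝ] E := fun x => fderiv ℝ (fun y => m (x, y)) a
  set R : E → E →L[ℝ] E := fun x => fderiv ℝ (fun y => m (y, x)) a
  have hLd : DifferentiableAt ℝ L a := (hasFDerivAt_fderiv_snd hm).differentiableAt
  have hRd : DifferentiableAt ℝ R a := (hasFDerivAt_fderiv_fst hm).differentiableAt
  have hLa : L a = 1 := (Filter.EventuallyEq.fderiv_eq (f₁ := fun y => m (a, y)) hm_left).trans
    fderiv_id
  have hRa : R a = 1 := (Filter.EventuallyEq.fderiv_eq (f₁ := fun y => m (y, a)) hm_right).trans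
    fderiv_id
  have hKa : K a = 1 := by
    have h : L a = R a * K a := hmK.self_of_nhds
    rwa [hLa, hRa, one_mul, eq_comm] at h
  have hfield : ∀ {S : E → E →L[ℝ] E}, DifferentiableAt ℝ S a → ∀ Z W,
      fderiv ℝ (fun x => S x Z) a W = fderiv ℝ S a W Z := fun hS Z W => by
    rw [fderiv_clm_apply hS (differentiableAt_const Z)]
    simp
  have hprod : fderiv ℝ L a X Y = fderiv ℝ R a X Y + fderiv ℝ K a X Y := by
    have h : (fun x => L x Y) =ᶠ[𝓝 a] fun x => R x (K x Y) :=
      hmK.mono fun x hx => DFunLike.congr_fun hx Y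
    rw [← hfield hLd, h.fderiv_eq, fderiv_clm_apply hRd (hK.clm_apply (differentiableAt_const Y))]
    simp [hRa, hKa, hfield hK, add_comm]
  have hsymm : fderiv ℝ R a X Y = fderiv ℝ L a Y X :=
    (fderiv_fderiv_snd_eq_fderiv_fderiv_fst hm Y X).symm
  have hbracket : VectorField.lieBracket ℝ (fun x => L x X) (fun x => L x Y) a =
      fderiv ℝ L a X Y - fderiv ℝ L a Y X := by
    simp only [VectorField.lieBracket, hfield hLd, hLa, one_apply_eq_self]
  exact (eq_sub_of_add_eq' (hsymm ▸ hprod).symm).trans hbracket.symm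

end LocalGroup

theorem eq_exp_smul_of_hasDerivAt_zero {𝔸 : Type*} [NormedRing 𝔸] [NormedAlgebra ℝ 𝔸]
    [CompleteSpace 𝔸] {T : ℝ → 𝔸} {D : 𝔸} (h0 : T 0 = 1)
    (hadd : ∀ s t, T (s + t) = T s * T t) (hD : HasDerivAt T D 0) (t : ℝ) :
    T t = NormedSpace.exp (t • D) := by
  have hT : ∀ t, HasDerivAt T (T t * D) t := fun t => by
    have hshift : HasDerivAt (fun s => T (s - t)) D t :=
      HasDerivAt.comp_sub_const t t (by simpa using hD)
    refine (hshift.const_mul (T t)).congr_of_eventuallyEq (.of_forall fun s => ?_)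
    simp only [← hadd, add_sub_cancel]
  have hconst : ∀ s, HasDerivAt (fun t => T t * NormedSpace.exp (t • -D)) 0 s := fun s =>
    ((hT s).mul (hasDerivAt_exp_smul_const' (-D) s)).congr_deriv (by simp [mul_assoc])
  have hone : T t * NormedSpace.exp (t • -D) = 1 := by
    simpa [h0] using is_const_of_deriv_eq_zero (fun s => (hconst s).differentiableAt)
      (fun s => (hconst s).deriv) t 0
  let _ : NormedAlgebra ℚ 𝔸 := NormedAlgebra.restrictScalars ℚ ℝ 𝔸
  have hinv : NormedSpace.exp (t • -D) * NormedSpace.exp (t • D) = 1 := by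
    have hcomm : Commute (t • -D) (t • D) := by simp
    rw [← NormedSpace.exp_add_of_commute hcomm, smul_neg, neg_add_cancel, NormedSpace.exp_zero]
  exact left_inv_eq_right_inv hone hinv

end Calculus

section Manifold

open VectorField

variable {E F E' : Type*} [NormedAddCommGroup E] [NormedSpace ℝ E] [NormedAddCommGroup F]
  [NormedSpace ℝ F] [NormedAddCommGroup E'] [NormedSpace ℝ E']
  {M N P : Type*} [TopologicalSpace M] [ChartedSpace E M] [TopologicalSpace N] [ChartedSpace F N]
  [TopologicalSpace P] [ChartedSpace E' P]

variable (E F) in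
/-- The manifold derivative, as an operator between the model spaces: unlike the tangent spaces,
they carry a norm, so that operator-valued families of derivatives can be differentiated. -/
def modelDeriv (f : M → N) (p : M) : E →L[ℝ] F := mfderiv 𝓘(ℝ, E) 𝓘(ℝ, F) f p

theorem modelDeriv_id (p : M) : modelDeriv E E (id : M → M) p = 1 := mfderiv_id

theorem modelDeriv_comp {f : N → P} {g : M → N} {p : M}
    (hf : MDifferentiableAt 𝓘(ℝ, F) 𝓘(ℝ, E') f (g p))
    (hg : MDifferentiableAt 𝓘(ℝ, E) 𝓘(ℝ, F) g p) :
    modelDeriv E E' (f ∘ g) p = modelDeriv F E' f (g p) ∘L modelDeriv E F g p :=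
  mfderiv_comp (I' := 𝓘(ℝ, F)) p hf hg

theorem modelDeriv_clm_comp (Φ : F →L[ℝ] E') {f : M → F} {p : M}
    (hf : MDifferentiableAt 𝓘(ℝ, E) 𝓘(ℝ, F) f p) :
    modelDeriv E E' (Φ ∘ f) p = Φ ∘L modelDeriv E F f p := by
  rw [modelDeriv_comp Φ.mdifferentiableAt hf, modelDeriv, Φ.mfderiv_eq]

theorem hasFDerivAt_comp_extChartAt_symm {f : M → F} {p : M}
    (hf : MDifferentiableAt 𝓘(ℝ, E) 𝓘(ℝ, F) f p) :
    HasFDerivAt (f ∘ (extChartAt 𝓘(ℝ, E) p).symm) (modelDeriv E F f p)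
      (extChartAt 𝓘(ℝ, E) p p) := by
  have h : HasFDerivWithinAt (f ∘ (extChartAt 𝓘(ℝ, E) p).symm) (modelDeriv E F f p)
      (Set.range 𝓘(ℝ, E)) (extChartAt 𝓘(ℝ, E) p p) := hf.hasMFDerivAt.2
  rwa [modelWithCornersSelf_coe, Set.range_id, hasFDerivWithinAt_univ] at h

theorem inTangentCoordinates_const {ι : Type*} [IsManifold 𝓘(ℝ, E) 1 M] [IsManifold 𝓘(ℝ, F) 1 N]
    (p : M) (q : N) (ϕ : ι → E →L[ℝ] F) (i : ι) :
    inTangentCoordinates 𝓘(ℝ, E) 𝓘(ℝ, F) (fun _ => p) (fun _ => q) ϕ i = ϕ := by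
  funext j
  rw [inTangentCoordinates_eq _ _ _ (mem_chart_source E p) (mem_chart_source F q)]
  ext v
  simp only [ContinuousLinearMap.comp_apply]
  rw [(tangentBundleCore 𝓘(ℝ, E) M).coordChange_self _ _ (mem_chart_source E p),
    (tangentBundleCore 𝓘(ℝ, F) N).coordChange_self _ _ (mem_chart_source F q)]

theorem contMDiff_modelDeriv_of_forall_eq [IsManifold 𝓘(ℝ, E) ∞ M] [IsManifold 𝓘(ℝ, F) ∞ N]
    [IsManifold 𝓘(ℝ, E') ∞ P] {f : P → M → N}
    (hf : ContMDiff (𝓘(ℝ, E').prod 𝓘(ℝ, E)) 𝓘(ℝ, F) ∞ (Function.uncurry f)) {p : M} {q : N}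
    (hpq : ∀ t, f t p = q) :
    ContMDiff 𝓘(ℝ, E') 𝓘(ℝ, E →L[ℝ] F) ∞ (fun t => modelDeriv E F (f t) p) := fun t => by
  have h := ContMDiffAt.mfderiv (m := ∞) (n := ∞) (x₀ := t) f (fun _ => p) (hf (t, p))
    contMDiffAt_const (by simp)
  simp only [hpq] at h
  rw [← inTangentCoordinates_const p q (fun t => modelDeriv E F (f t) p) t]
  exact h

theorem mlieBracket_eq_lieBracket_of_mpullbackWithin_eventuallyEq [IsManifold 𝓘(ℝ, E) 1 M] {p : M}
    {V W : Π x : M, TangentSpace 𝓘(ℝ, E) x} {v w : E → E}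
    (hV : mpullbackWithin 𝓘(ℝ, E) 𝓘(ℝ, E) (extChartAt 𝓘(ℝ, E) p).symm V (Set.range 𝓘(ℝ, E))
      =ᶠ[𝓝 (extChartAt 𝓘(ℝ, E) p p)] v)
    (hW : mpullbackWithin 𝓘(ℝ, E) 𝓘(ℝ, E) (extChartAt 𝓘(ℝ, E) p).symm W (Set.range 𝓘(ℝ, E))
      =ᶠ[𝓝 (extChartAt 𝓘(ℝ, E) p p)] w) :
    mlieBracket 𝓘(ℝ, E) V W p = lieBracket ℝ v w (extChartAt 𝓘(ℝ, E) p p) := by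
  have hid : ∀ L : E →L[ℝ] E, L = ContinuousLinearMap.id ℝ E → ∀ x, L.inverse x = x := by
    rintro L rfl x
    simp
  have huniv : lieBracketWithin ℝ v w
      ((extChartAt 𝓘(ℝ, E) p).symm ⁻¹' Set.univ ∩ Set.range 𝓘(ℝ, E)) (extChartAt 𝓘(ℝ, E) p p) =
      lieBracket ℝ v w (extChartAt 𝓘(ℝ, E) p p) := by
    rw [Set.preimage_univ, Set.univ_inter, modelWithCornersSelf_coe, Set.range_id,
      lieBracketWithin_univ]
  exact (hid _ mfderiv_extChartAt_self _).trans
    ((hV.lieBracketWithin_vectorField_eq_nhds hW).trans huniv)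

end Manifold

section LieGroup

open Filter VectorField

variable {E : Type*} [NormedAddCommGroup E] [NormedSpace ℝ E]
  {G : Type*} [TopologicalSpace G] [ChartedSpace E G] [Group G]

section ChartAtOne

variable (E G) in
/-- The identity of a Lie group in the chart at the identity. -/
def chartOne : E := extChartAt 𝓘(ℝ, E) (1 : G) 1

variable (E G) in
/-- The multiplication of a Lie group in the chart at the identity. Only its germ at
`(chartOne E G, chartOne E G)` is meaningful. -/
def chartMul (p : E × E) : E :=
  extChartAt 𝓘(ℝ, E) (1 : G)
    ((extChartAt 𝓘(ℝ, E) (1 : G)).symm p.1 * (extChartAt 𝓘(ℝ, E) (1 : G)).symm p.2)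

theorem extChartAt_symm_chartOne : (extChartAt 𝓘(ℝ, E) (1 : G)).symm (chartOne E G) = 1 :=
  extChartAt_to_inv (1 : G)

theorem eventually_mem_extChartAt_target :
    ∀ᶠ x in 𝓝 (chartOne E G), x ∈ (extChartAt 𝓘(ℝ, E) (1 : G)).target :=
  extChartAt_target_mem_nhds (1 : G)

theorem chartMul_chartOne_left : ∀ᶠ x in 𝓝 (chartOne E G), chartMul E G (chartOne E G, x) = x := by
  filter_upwards [eventually_mem_extChartAt_target] with x hx
  rw [chartMul, extChartAt_symm_chartOne, one_mul, PartialEquiv.right_inv _ hx]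

theorem chartMul_chartOne_right :
    ∀ᶠ x in 𝓝 (chartOne E G), chartMul E G (x, chartOne E G) = x := by
  filter_upwards [eventually_mem_extChartAt_target] with x hx
  rw [chartMul, extChartAt_symm_chartOne, mul_one, PartialEquiv.right_inv _ hx]

end ChartAtOne

variable [LieGroup 𝓘(ℝ, E) ∞ G]

theorem contMDiffAt_extChartAt_symm_chartOne :
    ContMDiffAt 𝓘(ℝ, E) 𝓘(ℝ, E) ∞ (extChartAt 𝓘(ℝ, E) (1 : G)).symm (chartOne E G) :=
  (contMDiffOn_extChartAt_symm (1 : G)).contMDiffAt (extChartAt_target_mem_nhds (1 : G))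

theorem contDiffAt_chartMul : ContDiffAt ℝ ∞ (chartMul E G) (chartOne E G, chartOne E G) := by
  have hsymm := contMDiffAt_extChartAt_symm_chartOne (E := E) (G := G)
  have hfst : ContMDiffAt 𝓘(ℝ, E × E) 𝓘(ℝ, E) ∞
      (fun p : E × E => (extChartAt 𝓘(ℝ, E) (1 : G)).symm p.1) (chartOne E G, chartOne E G) :=
    hsymm.comp (f := Prod.fst) (chartOne E G, chartOne E G) contDiffAt_fst.contMDiffAt
  have hsnd : ContMDiffAt 𝓘(ℝ, E × E) 𝓘(ℝ, E) ∞
      (fun p : E × E => (extChartAt 𝓘(ℝ, E) (1 : G)).symm p.2) (chartOne E G, chartOne E G) :=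
    hsymm.comp (f := Prod.snd) (chartOne E G, chartOne E G) contDiffAt_snd.contMDiffAt
  refine ContMDiffAt.contDiffAt ?_
  exact ContMDiffAt.comp_of_eq (y := (1 : G)) contMDiffAt_extChartAt (hfst.mul hsnd)
    (by rw [extChartAt_symm_chartOne, mul_one])

theorem mdifferentiable_mul_left (g : G) : MDifferentiable 𝓘(ℝ, E) 𝓘(ℝ, E) (fun x : G => g * x) :=
  (contMDiff_mul_left (I := 𝓘(ℝ, E)) (n := ∞)).mdifferentiable (by simp)

theorem mdifferentiable_mul_right (g : G) :
    MDifferentiable 𝓘(ℝ, E) 𝓘(ℝ, E) (fun x : G => x * g) :=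
  (contMDiff_mul_right (I := 𝓘(ℝ, E)) (n := ∞)).mdifferentiable (by simp)

theorem mdifferentiable_conj (g : G) : MDifferentiable 𝓘(ℝ, E) 𝓘(ℝ, E) (MulAut.conj g) :=
  (mdifferentiable_mul_right g⁻¹).comp (mdifferentiable_mul_left g)

theorem mdifferentiableAt_extChartAt_symm {x : E}
    (hx : x ∈ (extChartAt 𝓘(ℝ, E) (1 : G)).target) :
    MDifferentiableAt 𝓘(ℝ, E) 𝓘(ℝ, E) (extChartAt 𝓘(ℝ, E) (1 : G))
      ((extChartAt 𝓘(ℝ, E) (1 : G)).symm x) :=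
  mdifferentiableAt_extChartAt
    (extChartAt_source (I := 𝓘(ℝ, E)) (1 : G) ▸ PartialEquiv.map_target _ hx)

theorem fderiv_chartMul_left {x : E} (hx : x ∈ (extChartAt 𝓘(ℝ, E) (1 : G)).target) :
    fderiv ℝ (fun y => chartMul E G (x, y)) (chartOne E G) =
      modelDeriv E E (extChartAt 𝓘(ℝ, E) (1 : G) ∘ ((extChartAt 𝓘(ℝ, E) (1 : G)).symm x * ·)) 1 :=
  (hasFDerivAt_comp_extChartAt_symm (MDifferentiableAt.comp_of_eq _
    (mdifferentiableAt_extChartAt_symm hx) (mdifferentiable_mul_left _ _) (mul_one _))).fderiv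

theorem fderiv_chartMul_right {x : E} (hx : x ∈ (extChartAt 𝓘(ℝ, E) (1 : G)).target) :
    fderiv ℝ (fun y => chartMul E G (y, x)) (chartOne E G) =
      modelDeriv E E (extChartAt 𝓘(ℝ, E) (1 : G) ∘ (· * (extChartAt 𝓘(ℝ, E) (1 : G)).symm x)) 1 :=
  (hasFDerivAt_comp_extChartAt_symm (MDifferentiableAt.comp_of_eq _
    (mdifferentiableAt_extChartAt_symm hx) (mdifferentiable_mul_right _ _) (one_mul _))).fderiv

theorem mpullbackWithin_mulInvariantVectorField (Z : LieAlg E G) :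
    mpullbackWithin 𝓘(ℝ, E) 𝓘(ℝ, E) (extChartAt 𝓘(ℝ, E) (1 : G)).symm (mulInvariantVectorField Z)
        (Set.range 𝓘(ℝ, E)) =ᶠ[𝓝 (chartOne E G)]
      fun x => fderiv ℝ (fun y => chartMul E G (x, y)) (chartOne E G) Z := by
  filter_upwards [eventually_mem_extChartAt_target] with x hx
  set c := extChartAt 𝓘(ℝ, E) (1 : G)
  have hinverse : (mfderivWithin 𝓘(ℝ, E) 𝓘(ℝ, E) c.symm (Set.range 𝓘(ℝ, E)) x).inverse =
      mfderiv 𝓘(ℝ, E) 𝓘(ℝ, E) c (c.symm x) :=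
    ContinuousLinearMap.inverse_eq (mfderivWithin_extChartAt_symm_comp_mfderiv_extChartAt hx)
      (mfderiv_extChartAt_comp_mfderivWithin_extChartAt_symm hx)
  have hcomp : modelDeriv E E (c ∘ (c.symm x * ·)) 1 =
      modelDeriv E E c (c.symm x) ∘L modelDeriv E E (c.symm x * ·) 1 := by
    rw [modelDeriv_comp (by simpa only [mul_one] using mdifferentiableAt_extChartAt_symm hx)
      (mdifferentiable_mul_left _ _), mul_one]
  rw [mpullbackWithin_apply, hinverse, fderiv_chartMul_left hx, hcomp]
  rfl

theorem bracket_eq_lieBracket (X Y : LieAlg E G) :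
    ⁅X, Y⁆ = lieBracket ℝ
      (fun x => fderiv ℝ (fun y => chartMul E G (x, y)) (chartOne E G) X)
      (fun x => fderiv ℝ (fun y => chartMul E G (x, y)) (chartOne E G) Y) (chartOne E G) :=
  mlieBracket_eq_lieBracket_of_mpullbackWithin_eventuallyEq
    (mpullbackWithin_mulInvariantVectorField X) (mpullbackWithin_mulInvariantVectorField Y)

variable (E G) in
/-- The adjoint representation of a Lie group, on the model space `E` of its Lie algebra. -/
def Ad : G →* (E →L[ℝ] E) where
  toFun g := modelDeriv E E (MulAut.conj g) 1
  map_one' := by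
    rw [map_one]
    exact modelDeriv_id 1
  map_mul' g h := by
    rw [map_mul, MulAut.coe_mul, modelDeriv_comp (mdifferentiable_conj g _)
      (mdifferentiable_conj h _), map_one, ContinuousLinearMap.mul_def]

theorem contMDiff_Ad : ContMDiff 𝓘(ℝ, E) 𝓘(ℝ, E →L[ℝ] E) ∞ (Ad E G) :=
  contMDiff_modelDeriv_of_forall_eq (p := (1 : G)) (q := 1) (f := fun g x => g * x * g⁻¹)
    ((contMDiff_fst.mul contMDiff_snd).mul contMDiff_fst.inv) (by simp)

theorem mdifferentiable_Ad : MDifferentiable 𝓘(ℝ, E) 𝓘(ℝ, E →L[ℝ] E) (Ad E G) :=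
  contMDiff_Ad.mdifferentiable (by simp)

theorem modelDeriv_comp_mul_left_eq {f : G → E} {g : G}
    (hf : MDifferentiableAt 𝓘(ℝ, E) 𝓘(ℝ, E) f g) :
    modelDeriv E E (f ∘ (g * ·)) 1 = modelDeriv E E (f ∘ (· * g)) 1 * Ad E G g := by
  have hcomp : f ∘ (g * ·) = (f ∘ (· * g)) ∘ MulAut.conj g := by
    ext; simp
  have hfg : MDifferentiableAt 𝓘(ℝ, E) 𝓘(ℝ, E) (f ∘ (· * g)) (MulAut.conj g 1) :=
    MDifferentiableAt.comp_of_eq _ hf (mdifferentiable_mul_right g _) (by simp)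
  rw [hcomp, modelDeriv_comp hfg (mdifferentiable_conj g _), map_one]
  rfl

theorem modelDeriv_Ad_apply (X Y : LieAlg E G) :
    modelDeriv E (E →L[ℝ] E) (Ad E G) 1 X Y = (⁅X, Y⁆ : LieAlg E G) := by
  have hAd := hasFDerivAt_comp_extChartAt_symm (mdifferentiable_Ad (E := E) (1 : G))
  rw [bracket_eq_lieBracket, ← hAd.fderiv]
  refine fderiv_apply_eq_lieBracket_of_fderiv_eq_mul (contDiffAt_chartMul.of_le ENat.LEInfty.out)
    chartMul_chartOne_left chartMul_chartOne_right hAd.differentiableAt ?_ X Y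
  filter_upwards [eventually_mem_extChartAt_target] with x hx
  rw [fderiv_chartMul_left hx, fderiv_chartMul_right hx,
    modelDeriv_comp_mul_left_eq (mdifferentiableAt_extChartAt_symm hx)]
  rfl

theorem bilin_lie_add_bilin_lie_eq_zero {F : Type*} [NormedAddCommGroup F] [NormedSpace ℝ F]
    (B : E →L[ℝ] E →L[ℝ] F) (hB : ∀ g x y, B (Ad E G g x) (Ad E G g y) = B x y)
    (X Y Z : LieAlg E G) : B (⁅X, Y⁆ : LieAlg E G) Z + B Y (⁅X, Z⁆ : LieAlg E G) = 0 := by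
  have hAd := hasFDerivAt_comp_extChartAt_symm (mdifferentiable_Ad (E := E) (1 : G))
  rw [← modelDeriv_Ad_apply X Y, ← modelDeriv_Ad_apply X Z]
  exact bilin_deriv_add_bilin_deriv_eq B hAd
    ((congrArg (Ad E G) extChartAt_symm_chartOne).trans (map_one _))
    (hasFDerivAt_const (B Y Z) _) (fun _ => hB _ Y Z) X

section Hom

variable {F : Type*} [NormedAddCommGroup F] [NormedSpace ℝ F]
  {H : Type*} [TopologicalSpace H] [ChartedSpace F H] [Group H] [LieGroup 𝓘(ℝ, F) ∞ H]
  {f : G →* H}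

theorem modelDeriv_monoidHom_comp_Ad (hf : MDifferentiableAt 𝓘(ℝ, E) 𝓘(ℝ, F) f 1) (g : G) :
    modelDeriv E F f 1 ∘L Ad E G g = Ad F H (f g) ∘L modelDeriv E F f 1 := by
  have hcomm : f ∘ MulAut.conj g = MulAut.conj (f g) ∘ f := by
    ext; simp
  calc modelDeriv E F f 1 ∘L Ad E G g = modelDeriv E F (f ∘ MulAut.conj g) 1 := by
        rw [modelDeriv_comp (by rwa [map_one]) (mdifferentiable_conj g _), map_one]
        rfl
    _ = Ad F H (f g) ∘L modelDeriv E F f 1 := by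
        rw [hcomm, modelDeriv_comp (mdifferentiable_conj _ _) hf, map_one]
        rfl

variable [CompleteSpace E] [CompleteSpace F]

/-- The homomorphism of Lie algebras induced by a homomorphism of Lie groups. -/
def lieHom (f : G →* H) (hf : MDifferentiableAt 𝓘(ℝ, E) 𝓘(ℝ, F) f 1) :
    LieAlg E G →ₗ⁅ℝ⁆ LieAlg F H where
  toLinearMap := (modelDeriv E F f 1 : E →ₗ[ℝ] F)
  map_lie' {X Y} := by
    have hAd := mdifferentiable_Ad (E := E) (1 : G)
    have hAdf : MDifferentiableAt 𝓘(ℝ, F) 𝓘(ℝ, F →L[ℝ] F) (Ad F H) (f 1) := mdifferentiable_Ad _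
    have hderiv : modelDeriv E (E →L[ℝ] F)
          (ContinuousLinearMap.compL ℝ E E F (modelDeriv E F f 1) ∘ Ad E G) 1 =
        modelDeriv E (E →L[ℝ] F)
          ((ContinuousLinearMap.compL ℝ E F F).flip (modelDeriv E F f 1) ∘ Ad F H ∘ f) 1 :=
      congrArg (modelDeriv E (E →L[ℝ] F) · 1) (funext (modelDeriv_monoidHom_comp_Ad hf))
    rw [modelDeriv_clm_comp _ hAd, modelDeriv_clm_comp _ (hAdf.comp 1 hf), modelDeriv_comp hAdf hf,
      map_one] at hderiv
    have hXY := DFunLike.congr_fun (DFunLike.congr_fun hderiv X) Y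
    exact (congrArg (modelDeriv E F f 1) (modelDeriv_Ad_apply X Y)).symm.trans
      (hXY.trans (modelDeriv_Ad_apply (E := F) (G := H) _ _))

end Hom

end LieGroup

section ChainTransitivity

open Set MeasureTheory Function

section TopologicalGroup

variable {G : Type*} [TopologicalSpace G] [Group G] [IsTopologicalGroup G]

theorem eq_univ_of_mul_mem [ConnectedSpace G] {R W : Set G} (hR : R.Nonempty) (hW : W ∈ 𝓝 1)
    (hmul : ∀ x ∈ R, ∀ w ∈ W, x * w ∈ R) : R = univ := by
  refine IsClopen.eq_univ ⟨isOpen_compl_iff.1 ?_, ?_⟩ hR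
  · refine isOpen_iff_mem_nhds.2 fun z hz => ?_
    have hnear : ∀ᶠ g in 𝓝 z, g⁻¹ * z ∈ W :=
      ContinuousAt.preimage_mem_nhds (by fun_prop) (by simpa using hW)
    filter_upwards [hnear] with g hg hgR
    exact hz (by simpa using hmul g hgR _ hg)
  · refine isOpen_iff_mem_nhds.2 fun z hz => ?_
    have hnear : ∀ᶠ g in 𝓝 z, z⁻¹ * g ∈ W :=
      ContinuousAt.preimage_mem_nhds (by fun_prop) (by simpa using hW)
    filter_upwards [hnear] with g hg
    simpa using hmul z hz _ hg

theorem exists_mem_iterate_mem_of_surjective [CompactSpace G] {f : G →* G} (hf : Continuous f)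
    (hsurj : Surjective f) {V : Set G} (hV : IsOpen V) (hne : V.Nonempty) :
    ∃ v ∈ V, ∃ n ≠ 0, f^[n] v ∈ V := by
  borelize G
  have hmp : MeasurePreserving f (Measure.haar : Measure G) Measure.haar :=
    f.measurePreserving hf hsurj rfl
  exact hmp.conservative.exists_mem_iterate_mem hV.measurableSet.nullMeasurableSet
    (hV.measure_ne_zero _ hne)

theorem exists_isOpen_forall_inv_mul_mem {U : Set G} (hU : U ∈ 𝓝 1) :
    ∃ W, IsOpen W ∧ 1 ∈ W ∧ ∀ v ∈ W, ∀ w ∈ W, v⁻¹ * w ∈ U := by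
  obtain ⟨V, hVo, hV1, hVU⟩ := exists_open_nhds_one_mul_subset hU
  exact ⟨V ∩ V⁻¹, hVo.inter hVo.inv, ⟨hV1, by simpa using hV1⟩,
    fun v hv w hw => hVU (mul_mem_mul hv.2 hw.1)⟩

end TopologicalGroup

namespace Flow

variable {E : Type*} [NormedAddCommGroup E] [NormedSpace ℝ E]
  {G : Type*} [TopologicalSpace G] [ChartedSpace E G] [Group G]

theorem contMDiff_apply (φ : Flow E G) (t : ℝ) : ContMDiff 𝓘(ℝ, E) 𝓘(ℝ, E) ∞ (φ t) :=
  φ.smooth'.comp (contMDiff_const.prodMk contMDiff_id)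

theorem continuous_apply (φ : Flow E G) (t : ℝ) : Continuous (φ t) :=
  (φ.contMDiff_apply t).continuous

theorem apply_add (φ : Flow E G) (s t : ℝ) (g : G) : φ (s + t) g = φ s (φ t g) := by
  rw [φ.map_add', MulAut.mul_apply]

theorem iterate_apply (φ : Flow E G) (t : ℝ) (n : ℕ) (g : G) : (φ t)^[n] g = φ (n * t) g := by
  induction n with
  | zero => simp [φ.map_zero']
  | succ n ih =>
    rw [iterate_succ_apply', ih, ← φ.apply_add]
    push_cast
    ring_nf

/-- A single jump of a `(U, τ)`-chain; chains are the paths of this relation. -/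
def IsJump (φ : Flow E G) (U : Set G) (τ : ℝ) (x y : G) : Prop :=
  ∃ s, τ ≤ s ∧ y⁻¹ * φ s x ∈ U

theorem existsChain_of_transGen {φ : Flow E G} {U : Set G} {τ : ℝ} {x y : G}
    (h : Relation.TransGen (φ.IsJump U τ) x y) : φ.ExistsChain U τ x y := by
  induction h with
  | @single y h =>
    obtain ⟨s, hs, hU⟩ := h
    refine ⟨1, fun i => if i = 0 then x else y, fun _ => s, le_rfl, by simp, by simp, ?_⟩
    intro i hi
    obtain rfl : i = 0 := by omega
    simpa using ⟨hs, hU⟩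
  | @tail y z _ h ih =>
    obtain ⟨s, hs, hU⟩ := h
    obtain ⟨n, ξ, σ, hn, h0, hlast, hstep⟩ := ih
    refine ⟨n + 1, fun i => if i ≤ n then ξ i else z, fun i => if i < n then σ i else s,
      by omega, by simpa using h0, by simp, ?_⟩
    intro i hi
    rcases Nat.lt_or_ge i n with h | h
    · simpa [h, h.le, Nat.succ_le_iff.2 h] using hstep i h
    · obtain rfl : i = n := by omega
      simpa [hlast] using ⟨hs, hU⟩

variable [IsTopologicalGroup G] [CompactSpace G]

-- By recurrence, some `v` near `x` returns near `x` at a time `t ≥ 2τ`. The chain follows `x`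
-- for time `τ`, jumps from `φ_τ x` to the nearby `φ_τ v`, follows it until time `t`, and then jumps
-- from `φ_t v` to `x * w`.
theorem exists_nhds_transGen_isJump_mul (φ : Flow E G) {U : Set G} (hU : U ∈ 𝓝 1) {τ : ℝ}
    (hτ : 0 < τ) : ∃ W ∈ 𝓝 1, ∀ x, ∀ w ∈ W, Relation.TransGen (φ.IsJump U τ) x (x * w) := by
  have hpre : φ τ ⁻¹' U ∈ 𝓝 1 :=
    (φ.continuous_apply τ).continuousAt.preimage_mem_nhds (by simpa using hU)
  obtain ⟨W, hWo, hW1, hW⟩ := exists_isOpen_forall_inv_mul_mem (Filter.inter_mem hU hpre)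
  refine ⟨W, hWo.mem_nhds hW1, fun x w hw => ?_⟩
  have hne : ((x⁻¹ * ·) ⁻¹' W).Nonempty := ⟨x, by simpa using hW1⟩
  obtain ⟨v, hv, n, hn, hvn⟩ : ∃ v, x⁻¹ * v ∈ W ∧ ∃ n : ℕ, n ≠ 0 ∧ x⁻¹ * φ (n * (2 * τ)) v ∈ W := by
    simp only [← φ.iterate_apply]
    exact exists_mem_iterate_mem_of_surjective (f := (φ (2 * τ)).toMonoidHom) (φ.continuous_apply _)
      (φ (2 * τ)).surjective (hWo.preimage (continuous_const_mul x⁻¹)) hne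
  have hlate : τ ≤ n * (2 * τ) - τ := by
    have : (1 : ℝ) ≤ n := by exact_mod_cast Nat.one_le_iff_ne_zero.2 hn
    nlinarith
  refine .tail (.single (b := φ τ v) ⟨τ, le_rfl, ?_⟩) ⟨n * (2 * τ) - τ, hlate, ?_⟩
  · simpa using (hW _ hv _ hW1).2
  · rw [← φ.apply_add, sub_add_cancel]
    simpa [mul_assoc] using (hW _ hw _ hvn).1

variable [ConnectedSpace G]

theorem mem_chainLimitSet (φ : Flow E G) (x y : G) : y ∈ φ.chainLimitSet x := by
  intro U hU τ hτ
  obtain ⟨W, hW, hchain⟩ := φ.exists_nhds_transGen_isJump_mul hU hτ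
  have hreach : {y | Relation.TransGen (φ.IsJump U τ) x y} = univ :=
    eq_univ_of_mul_mem ⟨x * 1, hchain x 1 (mem_of_mem_nhds hW)⟩ hW
      fun z hz w hw => hz.trans (hchain z w hw)
  exact existsChain_of_transGen (eq_univ_iff_forall.1 hreach y)

theorem isChainTransitive (φ : Flow E G) : φ.IsChainTransitive :=
  ⟨univ, ⟨1, φ.mem_chainLimitSet 1 1, by simp [chainRecurrentSet, φ.mem_chainLimitSet]⟩, subset_rfl⟩

end Flow

end ChainTransitivity

section Flow

variable {E : Type*} [NormedAddCommGroup E] [NormedSpace ℝ E]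
  {G : Type*} [TopologicalSpace G] [ChartedSpace E G] [Group G]

namespace Flow

theorem modelDeriv_zero (φ : Flow E G) : modelDeriv E E (φ 0) 1 = 1 := by
  rw [φ.map_zero']
  exact modelDeriv_id 1

theorem mdifferentiable_apply (φ : Flow E G) (t : ℝ) :
    MDifferentiable 𝓘(ℝ, E) 𝓘(ℝ, E) (φ t) :=
  (φ.contMDiff_apply t).mdifferentiable (by simp)

theorem modelDeriv_add (φ : Flow E G) (s t : ℝ) :
    modelDeriv E E (φ (s + t)) 1 = modelDeriv E E (φ s) 1 * modelDeriv E E (φ t) 1 := by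
  rw [φ.map_add', MulAut.coe_mul, modelDeriv_comp (φ.mdifferentiable_apply _ _)
    (φ.mdifferentiable_apply _ _), map_one, ContinuousLinearMap.mul_def]

variable [LieGroup 𝓘(ℝ, E) ∞ G]

/-- The infinitesimal generator `D` of the differentials `(dφ_t)_e = exp (t D)`. -/
def generator (φ : Flow E G) : LieAlg E G →L[ℝ] LieAlg E G :=
  (deriv (fun t => modelDeriv E E (φ t) 1) 0 : E →L[ℝ] E)

theorem hasDerivAt_modelDeriv_zero (φ : Flow E G) :
    HasDerivAt (fun t => modelDeriv E E (φ t) 1) φ.generator 0 := by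
  have h : ContMDiff 𝓘(ℝ, ℝ) 𝓘(ℝ, E →L[ℝ] E) ∞ fun t => modelDeriv E E (φ t) 1 :=
    contMDiff_modelDeriv_of_forall_eq (p := (1 : G)) (q := 1) (f := fun t => φ t) φ.smooth'
      (by simp)
  exact (h.contDiff.differentiable (by simp) 0).hasDerivAt

variable [CompleteSpace E]

theorem modelDeriv_eq_exp (φ : Flow E G) (t : ℝ) :
    modelDeriv E E (φ t) 1 = NormedSpace.exp (𝔸 := E →L[ℝ] E) (t • φ.generator) :=
  eq_exp_smul_of_hasDerivAt_zero φ.modelDeriv_zero φ.modelDeriv_add φ.hasDerivAt_modelDeriv_zero t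

/-- The automorphism `(dφ_t)_e` of the Lie algebra. -/
def lieEquiv (φ : Flow E G) (t : ℝ) : LieAlg E G ≃ₗ⁅ℝ⁆ LieAlg E G where
  toLieHom := lieHom (φ t).toMonoidHom (φ.mdifferentiable_apply t 1)
  invFun := φ.diffAtOne (-t)
  left_inv v := by
    have h := φ.modelDeriv_add (-t) t
    rw [neg_add_cancel, φ.modelDeriv_zero] at h
    exact (DFunLike.congr_fun h v).symm
  right_inv v := by
    have h := φ.modelDeriv_add t (-t)
    rw [add_neg_cancel, φ.modelDeriv_zero] at h
    exact (DFunLike.congr_fun h v).symm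

theorem killingForm_diffAtOne (φ : Flow E G) (t : ℝ) (X Y : LieAlg E G) :
    killingForm ℝ (LieAlg E G) (φ.diffAtOne t X) (φ.diffAtOne t Y) =
      killingForm ℝ (LieAlg E G) X Y :=
  LieAlgebra.killingForm_of_equiv_apply (φ.lieEquiv t) X Y

theorem generator_lie (φ : Flow E G) (X Y : LieAlg E G) :
    φ.generator ⁅X, Y⁆ = ⁅φ.generator X, Y⁆ + ⁅X, φ.generator Y⁆ := by
  rw [← modelDeriv_Ad_apply, ← modelDeriv_Ad_apply, ← modelDeriv_Ad_apply]
  exact deriv_bilin_eq_of_forall_bilin_eq _ φ.hasDerivAt_modelDeriv_zero φ.modelDeriv_zero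
    (fun t u v => (modelDeriv_Ad_apply (G := G) _ _).trans <|
      (LieEquiv.map_lie (φ.lieEquiv t) u v).symm.trans <|
        congrArg (φ.lieEquiv t) (modelDeriv_Ad_apply u v).symm) X Y

/-- The derivation `D` of the Lie algebra with `(dφ_t)_e = exp (t D)`. -/
def derivation (φ : Flow E G) : LieDerivation ℝ (LieAlg E G) (LieAlg E G) where
  toLinearMap := φ.generator
  leibniz' X Y := by
    change φ.generator ⁅X, Y⁆ = ⁅X, φ.generator Y⁆ - ⁅Y, φ.generator X⁆
    rw [φ.generator_lie, ← lie_skew Y, add_comm, sub_neg_eq_add]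

variable [FiniteDimensional ℝ E]

theorem hasDerivation_derivation (φ : Flow E G) : φ.HasDerivation φ.derivation :=
  φ.modelDeriv_eq_exp

theorem isElliptic_of_killingForm_self_ne_zero (φ : Flow E G)
    (h : ∀ X ≠ 0, killingForm ℝ (LieAlg E G) X X ≠ 0) : φ.IsElliptic := by
  have : FiniteDimensional ℝ (LieAlg E G) := inferInstanceAs (FiniteDimensional ℝ E)
  exact ⟨φ.derivation, φ.hasDerivation_derivation,
    isEllipticEnd_of_isSkewAdjoint (B := killingForm ℝ (LieAlg E G))
      ⟨LieModule.traceForm_comm ℝ (LieAlg E G) (LieAlg E G)⟩ (fun X => not_imp_not.1 (h X))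
      (killingForm_isSkewAdjoint φ.derivation)⟩

end Flow

end Flow

section CompactLieGroup

variable {E : Type*} [NormedAddCommGroup E] [NormedSpace ℝ E] [FiniteDimensional ℝ E]
  [CompleteSpace E]
  {G : Type*} [TopologicalSpace G] [ChartedSpace E G] [Group G] [LieGroup 𝓘(ℝ, E) ∞ G]
  [CompactSpace G]

theorem killingForm_neg_of_compactSpace (hcenter : LieAlgebra.center ℝ (LieAlg E G) = ⊥)
    {X : LieAlg E G} (hX : X ≠ 0) : killingForm ℝ (LieAlg E G) X X < 0 := by
  have : IsTopologicalGroup G := topologicalGroup_of_lieGroup 𝓘(ℝ, E) ∞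
  have : FiniteDimensional ℝ (LieAlg E G) := inferInstanceAs (FiniteDimensional ℝ E)
  obtain ⟨B, hsymm, hpos, hinv⟩ :=
    exists_isSymm_pos_invariant_bilinForm (contMDiff_Ad (E := E) (G := G)).continuous
  exact killingForm_neg_of_lieInvariant (B := (B : LinearMap.BilinForm ℝ E)) hcenter hsymm hpos
    (fun X Y Z => eq_neg_of_add_eq_zero_left
      (bilin_lie_add_bilin_lie_eq_zero (LinearMap.toContinuousBilinearMap B) hinv X Y Z)) hX

end CompactLieGroup

end AutomorphismFlow

end

theorem proposition4p3 {E : Type*} [NormedAddCommGroup E] [NormedSpace ℝ E]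
    [FiniteDimensional ℝ E] [CompleteSpace E]
    {G : Type*} [TopologicalSpace G] [ChartedSpace E G] [Group G] [LieGroup 𝓘(ℝ, E) ∞ G]
    [CompactSpace G] [ConnectedSpace G]
    [LieAlgebra.IsSemisimple ℝ (AutomorphismFlow.LieAlg E G)]
    (φ : AutomorphismFlow.Flow E G) :
    -- the negative Killing form is positive definite, and invariant under the flow
    (∀ X : AutomorphismFlow.LieAlg E G, X ≠ 0 →
      0 < -(killingForm ℝ (AutomorphismFlow.LieAlg E G) X X)) ∧
    (∀ (t : ℝ) (X Y : AutomorphismFlow.LieAlg E G),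
      killingForm ℝ (AutomorphismFlow.LieAlg E G) (φ.diffAtOne t X) (φ.diffAtOne t Y) =
        killingForm ℝ (AutomorphismFlow.LieAlg E G) X Y) ∧
    φ.IsElliptic ∧ φ.IsChainTransitive := by
  have : IsTopologicalGroup G := topologicalGroup_of_lieGroup 𝓘(ℝ, E) ∞
  have hneg : ∀ X ≠ 0, killingForm ℝ (AutomorphismFlow.LieAlg E G) X X < 0 := fun X hX =>
    AutomorphismFlow.killingForm_neg_of_compactSpace (LieAlgebra.center_eq_bot _ _) hX
  exact ⟨fun X hX => neg_pos.2 (hneg X hX), φ.killingForm_diffAtOne,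
    φ.isElliptic_of_killingForm_self_ne_zero fun X hX => (hneg X hX).ne, φ.isChainTransitive⟩
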